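/- Fix $k\in\mathbb N$, $k\ge 1$, $\alpha>0$, $\beta>1$, $T>0$ and a continuous $\gamma:\mathbb T=\mathbb R/\mathbb Z\to[0,1]$. For $n\ge1$ let $\mathbb T_{nk}=\mathbb Z/nk\mathbb Z$ and let $(\eta^n_t)_{t\ge0}$ be the Markov process on $\{0,1\}^{\mathbb T_{nk}}$ with generator $k^2n^{1+\beta}\mathcal L_n$ (the exclusion process with $k$ slow bonds, speeded up by $k^2n^{1+\beta}$), where $$(\mathcal L_nf)(\eta)=\sum_{x\in\mathbb T_{nk}}\xi_{x,x+1}\,[f(\eta^{x,x+1})-f(\eta)],$$ $\eta^{x,x+1}$ is $\eta$ with the values at $x$ and $x+1$ exchanged, $\xi_{x,x+1}=\alpha n^{-\beta}$ if $x=jn-1$ for some $j\in\{1,\dots,k\}$, and $\xi_{x,x+1}=1$ otherwise. Suppose that $\eta^n_0$ is distributed according to the Bernoulli product measure $\mu^n$ with $\mu^n\{\eta(x)=1\}=\gamma(x/nk)$ for all $x\in\mathbb T_{nk}$. Let $$\pi^n_t=\frac1k\sum_{i=0}^{k-1}\Big(\frac1n\sum_{x=in}^{(i+1)n-1}\eta^n_t(x)\Big)\delta_{i/k}$$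 be the box-averaged empirical measure on $\mathbb T$. The discrete heat equation $$\partial_t\rho_t(i)=\alpha\Delta_k\rho_t(i),\qquad \rho_0(i)=k\int_{i/k}^{(i+1)/k}\gamma(u)\,du,\qquad i\in\mathbb T_k=\mathbb Z/k\mathbb Z,$$ with $\Delta_k\rho(i)=k^2[\rho(i+1)+\rho(i-1)-2\rho(i)]$, has a unique solution $\rho$ on $[0,T]$, it takes values in $[0,1]$, and for every $t\in[0,T]$ the random measures $\pi^n_t$ converge in probability, as $n\to\infty$ and with respect to the weak topology, to the deterministic measure $$\pi_t=\frac1k\sum_{i=0}^{k-1}\rho_t(i)\,\delta_{i/k}.$$ -/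

import Mathlib

open Filter Topology MeasureTheory ProbabilityTheory
open scoped NNReal ENNReal unitInterval

namespace SlowBonds

noncomputable section

/-! ### Continuous-time Markov processes on a finite state space -/

section Markov

variable {S : Type*} [Fintype S] {Ω : Type*} [MeasurableSpace Ω]

/-- The operator `exp (t L)` of the Markov semigroup generated by `L`, acting on functions on a
finite state space. -/
def semigroup (L : (S → ℝ) →ₗ[ℝ] (S → ℝ)) (t : ℝ≥0) : (S → ℝ) →L[ℝ] (S → ℝ) :=
  NormedSpace.exp ((t : ℝ) • LinearMap.toContinuousLinearMap L)

/-- The information about `X` up to time `s`, that is, `σ(X r : r ≤ s)`. -/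
@[reducible] def past [MeasurableSpace S] (X : ℝ≥0 → Ω → S) (s : ℝ≥0) : MeasurableSpace Ω :=
  ⨆ r : {r : ℝ≥0 // r ≤ s}, MeasurableSpace.comap (X r) inferInstance

/-- Under `P`, the process `X` is a Markov process with (time-homogeneous) generator `L` and initial
distribution `μ`: `E[f(X_{s+t}) | σ(X_r : r ≤ s)] = (exp(tL) f)(X_s)` almost surely.
No path regularity is asked for: it does not affect the finite-dimensional distributions. -/
structure IsMarkovProcess [MeasurableSpace S] (P : Measure Ω) (X : ℝ≥0 → Ω → S)
    (L : (S → ℝ) →ₗ[ℝ] (S → ℝ)) (μ : Measure S) : Prop where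
  measurable : ∀ t, Measurable (X t)
  initial : P.map (X 0) = μ
  markov : ∀ (s t : ℝ≥0) (f : S → ℝ),
    P[fun ω => f (X (s + t) ω) | past X s] =ᵐ[P] fun ω => semigroup L t f (X s ω)

end Markov

/-! ### The exclusion process with slow bonds -/

/-- Configurations `{0,1}^{𝕋_N}` of particles on the discrete torus with `N` sites
(`true` means that the site is occupied). -/
abbrev Config (N : ℕ) : Type := ZMod N → Bool

/-- The configuration `η^{x,x+1}`, in which the occupation variables at `x` and `x + 1` are
exchanged. -/
def exchange {N : ℕ} (η : Config N) (x : ZMod N) : Config N :=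
  fun y => η (Equiv.swap x (x + 1) y)

/-- The conductance of the bond `(x, x+1)` on the torus with `n * k` sites:
`α n^{-β}` if `x = j n - 1` for some `j ∈ {1, …, k}`, and `1` otherwise. -/
def conductance (n k : ℕ) (α β : ℝ) (x : ZMod (n * k)) : ℝ :=
  if ∃ j ∈ Finset.Icc 1 k, x.val + 1 = j * n then α * (n : ℝ) ^ (-β) else 1

/-- The generator `(L f)(η) = ∑_x ξ_{x,x+1} [f(η^{x,x+1}) - f(η)]`. -/
def generator (n k : ℕ) [NeZero n] [NeZero k] (α β : ℝ) :
    (Config (n * k) → ℝ) →ₗ[ℝ] (Config (n * k) → ℝ) where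
  toFun f η := ∑ x : ZMod (n * k), conductance n k α β x * (f (exchange η x) - f η)
  map_add' f g := by
    funext η
    simp only [Pi.add_apply, ← Finset.sum_add_distrib]
    exact Finset.sum_congr rfl fun x _ => by ring
  map_smul' c f := by
    funext η
    simp only [Pi.smul_apply, smul_eq_mul, RingHom.id_apply, Finset.mul_sum]
    exact Finset.sum_congr rfl fun x _ => by ring

/-- The point `i / N` of the continuous torus `ℝ / ℤ`, for `i` in the discrete torus. -/
def torusPoint {N : ℕ} (i : ZMod N) : UnitAddCircle := ((i.val / N : ℝ) : UnitAddCircle)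

/-- The product measure on configurations under which `x` is occupied with probability
`γ (x / N)`. -/
def initialMeasure (N : ℕ) [NeZero N] (γ : C(UnitAddCircle, I)) : Measure (Config N) :=
  Measure.pi fun x => bernoulliMeasure true false (γ (torusPoint x))

/-- The proportion of occupied sites among the `n` sites `i n, …, (i + 1) n - 1` of the `i`-th
box. -/
def boxAverage {n k : ℕ} (η : Config (n * k)) (i : ZMod k) : ℝ≥0 :=
  (∑ j ∈ Finset.range n, if η ((i.val * n + j : ℕ) : ZMod (n * k)) then 1 else 0) / n

/-- The measure `(1 / k) ∑_i w(i) δ_{i/k}` on the continuous torus. -/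
def atomicMeasure {k : ℕ} [NeZero k] (w : ZMod k → ℝ≥0) : FiniteMeasure UnitAddCircle :=
  ∑ i : ZMod k, (w i / k) • (diracProba (torusPoint i)).toFiniteMeasure

/-- The box-averaged empirical measure `π^n(η, du)`. -/
def empirical {n k : ℕ} [NeZero k] (η : Config (n * k)) : FiniteMeasure UnitAddCircle :=
  atomicMeasure (boxAverage η)

/-! ### The discrete heat equation -/

/-- The discrete Laplacian `Δ_k ρ(i) = k² [ρ(i+1) + ρ(i-1) - 2 ρ(i)]` on `𝕋_k`. -/
def discreteLaplacian {k : ℕ} (ρ : ZMod k → ℝ) (i : ZMod k) : ℝ :=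
  (k : ℝ) ^ 2 * (ρ (i + 1) + ρ (i - 1) - 2 * ρ i)

/-- The average `k ∫_{i/k}^{(i+1)/k} γ(u) du` of the profile over the `i`-th box. -/
def profileAverage {k : ℕ} (γ : C(UnitAddCircle, I)) (i : ZMod k) : ℝ :=
  k * ∫ u in (i.val / k : ℝ)..((i.val + 1) / k : ℝ), (γ (u : UnitAddCircle) : ℝ)

/-- `ρ` solves `∂_t ρ = α Δ_k ρ` on `[0, T]` and starts from the box averages of `γ`. -/
structure SolvesHeat {k : ℕ} (α T : ℝ) (γ : C(UnitAddCircle, I)) (ρ : ℝ → ZMod k → ℝ) : Prop where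
  initial : ∀ i, ρ 0 i = profileAverage γ i
  deriv : ∀ t ∈ Set.Icc 0 T, ∀ i,
    HasDerivWithinAt (fun s => ρ s i) (α * discreteLaplacian (ρ t) i) (Set.Icc 0 T) t

/-- Convergence in probability of the random elements `Y a` of a topological space, each defined on
its own probability space, to the constant `y`. -/
def TendstoInProb {A E : Type*} [TopologicalSpace E] {Ω : A → Type*}
    [∀ a, MeasurableSpace (Ω a)] (P : ∀ a, Measure (Ω a)) (Y : ∀ a, Ω a → E) (l : Filter A)
    (y : E) : Prop :=
  ∀ U ∈ 𝓝 y, Tendsto (fun a => P a {ω | Y a ω ∉ U}) l (𝓝 0)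

end

end SlowBonds

namespace SlowBonds

/-! ### Linear flows and expectations of a Markov process -/

section Flow

/-! The exclusion generator maps linear statistics of the configuration to linear statistics, so the
expected occupations `u` solve exactly the heat equation of a random walk with the sped-up
conductances (`hasDerivAt_meanProfile`). Two estimates at a fixed time then suffice.

Mean. In the evolution of a box average of `u` only the fluxes through slow bonds survive. Their
rate is of order `n`, which cancels the `1/n` of the average. If `u` were constant on boxes, the
averages would solve the discrete heat equation. The error is controlled by the Dirichlet energy
inside the boxes, where bonds have rate of order `n^(1+β)`. Adding a multiple `C ≈ n^(-β)` of `∑ u²`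
to the squared distance makes the dissipation of `u` absorb this error (`boxMean_dissipation`).
Grönwall's inequality costs only the initial value of the added term, of order `n^(1-β)`, and the
Riemann sum error at time zero.

Variance. Transport the coefficients of a linear statistic backwards by the random walk. The
variance then grows no faster than half the square sum of the coefficients, because occupations of
neighbours differ by at most one (`variance_linearStat_le`). No correlation estimate is needed, and
box averages have variance at most `1/(2n)`.

Chebyshev's inequality combines the two, and finitely many converging weights give weak convergence
of the atomic measures. -/

/-- A linear differential equation with constant coefficients has a global solution. -/
lemma exists_linear_flow {ι : Type*} [Fintype ι] (A : (ι → ℝ) →ₗ[ℝ] (ι → ℝ)) (a : ι → ℝ) :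
    ∃ b : ℝ → ι → ℝ, b 0 = a ∧ ∀ s, HasDerivAt b (A (b s)) s := by
  refine ⟨fun s => NormedSpace.exp (s • LinearMap.toContinuousLinearMap A) a, by simp, fun s => ?_⟩
  have h := (hasDerivAt_exp_smul_const' (𝕂 := ℝ) (LinearMap.toContinuousLinearMap A) s).clm_apply
    (hasDerivAt_const s a)
  simpa using h

variable {S : Type*} [Fintype S] {Ω : Type*} [MeasurableSpace Ω]

/-- The one-time expectations of a Markov process solve the forward equation. -/
lemma IsMarkovProcess.exists_expectation [MeasurableSpace S] [MeasurableSingletonClass S]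
    {P : Measure Ω} [IsProbabilityMeasure P] {X : ℝ≥0 → Ω → S}
    {L : (S → ℝ) →ₗ[ℝ] (S → ℝ)} {μ : Measure S} (hX : IsMarkovProcess P X L μ) :
    ∃ Φ : ℝ → (S → ℝ) →L[ℝ] ℝ,
      (∀ s, HasDerivAt Φ ((Φ s).comp (LinearMap.toContinuousLinearMap L)) s) ∧
      ∀ (s : ℝ≥0) (f : S → ℝ), Φ s f = ∫ ω, f (X s ω) ∂P := by
  have hint : ∀ (f : S → ℝ) (s : ℝ≥0), Integrable (fun ω => f (X s ω)) P := fun f s =>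
    Integrable.of_finite (μ := P.map (X s)) (f := f) |>.comp_measurable (hX.measurable s)
  let E : (S → ℝ) →ₗ[ℝ] ℝ :=
    { toFun := fun f => ∫ ω, f (X 0 ω) ∂P
      map_add' := fun f g => integral_add (hint f 0) (hint g 0)
      map_smul' := fun c f => integral_const_mul c _ }
  let E' := LinearMap.toContinuousLinearMap E
  -- Defined for every real time so that derivatives are two-sided; only nonnegative times have a
  -- probabilistic meaning.
  refine ⟨fun s => E'.comp (NormedSpace.exp (s • LinearMap.toContinuousLinearMap L)), ?_, ?_⟩
  · intro s
    have h := (hasDerivAt_const s E').clm_comp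
      (hasDerivAt_exp_smul_const (𝕂 := ℝ) (LinearMap.toContinuousLinearMap L) s)
    rw [ContinuousLinearMap.zero_comp, zero_add] at h
    exact h
  · intro s f
    -- The Markov property at time zero, integrated: conditioning on the past of time zero
    -- disappears.
    have hle : past X 0 ≤ (inferInstance : MeasurableSpace Ω) :=
      iSup_le fun r => (hX.measurable r.1).comap_le
    have h := integral_congr_ae (hX.markov 0 s f)
    rw [integral_condExp hle] at h
    simp only [zero_add] at h
    rw [h]
    rfl

/-- Product rule along the forward equation. -/
lemma hasDerivAt_forward {L : (S → ℝ) →ₗ[ℝ] (S → ℝ)} {Φ : ℝ → (S → ℝ) →L[ℝ] ℝ}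
    (hΦ : ∀ s, HasDerivAt Φ ((Φ s).comp (LinearMap.toContinuousLinearMap L)) s)
    {f : ℝ → S → ℝ} {f' : S → ℝ} {s : ℝ} (hf : HasDerivAt f f' s) :
    HasDerivAt (fun r => Φ r (f r)) (Φ s (L (f s) + f')) s := by
  have h := (hΦ s).clm_apply hf
  simpa using h

end Flow

/-! ### Dirichlet forms on the discrete torus -/

section Torus

variable {N : ℕ} [NeZero N]

/-- The bilinear Dirichlet form with conductances `c`. -/
noncomputable def dirichletForm (c a b : ZMod N → ℝ) : ℝ :=
  ∑ x, c x * ((a (x + 1) - a x) * (b (x + 1) - b x))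

/-- The generator of the random walk with conductances `c`. -/
noncomputable def bondLaplacian (c : ZMod N → ℝ) : (ZMod N → ℝ) →ₗ[ℝ] (ZMod N → ℝ) where
  toFun a x := c x * (a (x + 1) - a x) + c (x - 1) * (a (x - 1) - a x)
  map_add' a b := by funext x; simp only [Pi.add_apply]; ring
  map_smul' r a := by funext x; simp only [Pi.smul_apply, smul_eq_mul, RingHom.id_apply]; ring

lemma sum_shift (f : ZMod N → ℝ) : ∑ x, f (x + 1) = ∑ x, f x :=
  Equiv.sum_comp (Equiv.addRight (1 : ZMod N)) f

/-- Summation by parts; on the torus shifting the backward differences leaves no boundary term. -/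
lemma sum_bondLaplacian_mul (c a b : ZMod N → ℝ) :
    ∑ x, bondLaplacian c a x * b x = -dirichletForm c a b := by
  have h := sum_shift fun x => c (x - 1) * (a (x - 1) - a x) * b x
  simp only [add_sub_cancel_right] at h
  simp only [bondLaplacian, LinearMap.coe_mk, AddHom.coe_mk, add_mul, Finset.sum_add_distrib]
  rw [← h, dirichletForm, ← Finset.sum_add_distrib, ← Finset.sum_neg_distrib]
  exact Finset.sum_congr rfl fun x _ => by ring

lemma dirichletForm_comm (c a b : ZMod N → ℝ) : dirichletForm c a b = dirichletForm c b a :=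
  Finset.sum_congr rfl fun x _ => by ring

lemma dirichletForm_self_nonneg {c : ZMod N → ℝ} (hc : ∀ x, 0 ≤ c x) (a : ZMod N → ℝ) :
    0 ≤ dirichletForm c a a :=
  Finset.sum_nonneg fun x _ => mul_nonneg (hc x) (mul_self_nonneg _)

/-- The occupation variable at `x`. -/
def occupation (η : Config N) (x : ZMod N) : ℝ := if η x then 1 else 0

/-- The linear statistic `∑ₓ a(x) η(x)`. -/
noncomputable def linearStat (a : ZMod N → ℝ) (η : Config N) : ℝ := ∑ x, a x * occupation η x

lemma linearStat_exchange (a : ZMod N → ℝ) (η : Config N) (x : ZMod N) :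
    linearStat a (exchange η x) - linearStat a η =
      -((a (x + 1) - a x) * (occupation η (x + 1) - occupation η x)) := by
  have h : linearStat a (exchange η x) = ∑ y, a (Equiv.swap x (x + 1) y) * occupation η y := by
    rw [linearStat, ← Equiv.sum_comp (Equiv.swap x (x + 1))]
    exact Finset.sum_congr rfl fun y _ => by simp [occupation, exchange]
  rw [h, linearStat, ← Finset.sum_sub_distrib]
  -- This happens only for `N = 1`, where the exchange is trivial.
  by_cases hx : x + 1 = x
  · simp [hx]
  rw [Finset.sum_eq_add (x + 1) x hx]
  · simp only [Equiv.swap_apply_left, Equiv.swap_apply_right]; ring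
  · intro y _ hy
    rw [Equiv.swap_apply_of_ne_of_ne hy.2 hy.1, sub_self]
  · simp
  · simp

/-- `L` is the generator of the exclusion process with conductances `c`. -/
def IsExclusionGenerator (c : ZMod N → ℝ) (L : (Config N → ℝ) →ₗ[ℝ] (Config N → ℝ)) : Prop :=
  ∀ f η, L f η = ∑ x, c x * (f (exchange η x) - f η)

/-- An exchange changes a linear statistic by a product of discrete gradients, and summation by
parts turns the total into a linear statistic again. This closes the equation for the mean. -/
lemma IsExclusionGenerator.linearStat {c : ZMod N → ℝ}
    {L : (Config N → ℝ) →ₗ[ℝ] (Config N → ℝ)} (hL : IsExclusionGenerator c L) (a : ZMod N → ℝ) :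
    L (linearStat a) = linearStat (bondLaplacian c a) := by
  funext η
  rw [hL, SlowBonds.linearStat.eq_1 (bondLaplacian c a), sum_bondLaplacian_mul, dirichletForm, ← Finset.sum_neg_distrib]
  exact Finset.sum_congr rfl fun x _ => by rw [linearStat_exchange]; ring

/-- Expanding the square of each increment: the last sum is the carré du champ. -/
lemma IsExclusionGenerator.sq_linearStat {c : ZMod N → ℝ}
    {L : (Config N → ℝ) →ₗ[ℝ] (Config N → ℝ)} (hL : IsExclusionGenerator c L) (a : ZMod N → ℝ)
    (κ : ℝ) (η : Config N) :
    L (fun ζ => (SlowBonds.linearStat a ζ - κ) ^ 2) η =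
      2 * (SlowBonds.linearStat a η - κ) * SlowBonds.linearStat (bondLaplacian c a) η +
      ∑ x, c x * ((a (x + 1) - a x) * (occupation η (x + 1) - occupation η x)) ^ 2 := by
  rw [hL, ← hL.linearStat, hL, Finset.mul_sum, ← Finset.sum_add_distrib]
  refine Finset.sum_congr rfl fun x _ => ?_
  have h := linearStat_exchange a η x
  rw [sub_eq_iff_eq_add] at h
  rw [h]
  ring

end Torus

end SlowBonds
namespace SlowBonds

/-! ### One-time mean and variance of linear statistics -/

section Moments

lemma occupation_nonneg {N : ℕ} (η : Config N) (x : ZMod N) : 0 ≤ occupation η x := by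
  unfold occupation; split_ifs <;> norm_num

lemma occupation_le_one {N : ℕ} (η : Config N) (x : ZMod N) : occupation η x ≤ 1 := by
  unfold occupation; split_ifs <;> norm_num

variable {N : ℕ} [NeZero N] {c : ZMod N → ℝ} {L : (Config N → ℝ) →ₗ[ℝ] (Config N → ℝ)}
  {Φ : ℝ → (Config N → ℝ) →L[ℝ] ℝ}

/-- The expected density profile. -/
def meanProfile (Φ : ℝ → (Config N → ℝ) →L[ℝ] ℝ) (s : ℝ) (x : ZMod N) : ℝ :=
  Φ s fun η => occupation η x

lemma expectation_linearStat (s : ℝ) (a : ZMod N → ℝ) :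
    Φ s (linearStat a) = ∑ x, a x * meanProfile Φ s x := by
  have h : linearStat a = ∑ x, a x • fun η : Config N => occupation η x := by
    funext η; simp [linearStat]
  rw [h, map_sum]
  simp [meanProfile]

lemma linearStat_single (x : ZMod N) :
    linearStat (Pi.single x 1) = fun η => occupation η x := by
  funext η; simp [linearStat, Pi.single_apply]

lemma hasDerivAt_meanProfile (hL : IsExclusionGenerator c L)
    (hΦ : ∀ s, HasDerivAt Φ ((Φ s).comp (LinearMap.toContinuousLinearMap L)) s) (s : ℝ) :
    HasDerivAt (meanProfile Φ) (bondLaplacian c (meanProfile Φ s)) s := by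
  rw [hasDerivAt_pi]
  intro x
  have h := hasDerivAt_forward hΦ (hasDerivAt_const s (linearStat (Pi.single x (1 : ℝ))))
  -- Self-adjointness moves the Laplacian from the indicator of `x` to the mean profile.
  rw [add_zero, hL.linearStat, expectation_linearStat, sum_bondLaplacian_mul, dirichletForm_comm,
    ← sum_bondLaplacian_mul] at h
  simp only [linearStat_single, Pi.single_apply, mul_ite, mul_one, mul_zero,
    Finset.sum_ite_eq', Finset.mem_univ, if_true] at h
  exact h

lemma hasDerivAt_linearStat {b : ℝ → ZMod N → ℝ} {b' : ZMod N → ℝ} {s : ℝ}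
    (hb : HasDerivAt b b' s) : HasDerivAt (fun r => linearStat (b r)) (linearStat b') s := by
  rw [hasDerivAt_pi] at hb ⊢
  intro η
  exact HasDerivAt.fun_sum fun x _ => (hb x).mul_const _

lemma linearStat_neg (a : ZMod N → ℝ) (η : Config N) : linearStat (-a) η = -linearStat a η := by
  simp [linearStat]

/-- The variance of a linear statistic stays below half of the square sum of its coefficients, when
this holds at time zero. -/
lemma variance_linearStat_le (hL : IsExclusionGenerator c L)
    (hΦ : ∀ s, HasDerivAt Φ ((Φ s).comp (LinearMap.toContinuousLinearMap L)) s)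
    (hle : ∀ s, 0 ≤ s → ∀ (f : Config N → ℝ) (C : ℝ), (∀ η, f η ≤ C) → Φ s f ≤ C)
    (hc : ∀ x, 0 ≤ c x)
    (h0 : ∀ a, Φ 0 (fun η => (linearStat a η - Φ 0 (linearStat a)) ^ 2) ≤ (∑ x, a x ^ 2) / 2)
    {t : ℝ} (ht : 0 ≤ t) (a : ZMod N → ℝ) :
    Φ t (fun η => (linearStat a η - Φ t (linearStat a)) ^ 2) ≤ (∑ x, a x ^ 2) / 2 := by
  -- Reversed in time, this flow makes the drift of the linear statistic vanish, so its mean is the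
  -- constant `κ`.
  obtain ⟨w, hw0, hw⟩ := exists_linear_flow (bondLaplacian c) a
  let b : ℝ → ZMod N → ℝ := fun s => w (t - s)
  have hb : ∀ s, HasDerivAt b (-bondLaplacian c (b s)) s := fun s => by
    have h := (hw (t - s)).scomp s ((hasDerivAt_id s).const_sub t)
    simpa [b, Function.comp_def] using h
  have hbt : b t = a := by simp [b, hw0]
  have hconst : ∀ s, Φ s (linearStat (b s)) = Φ t (linearStat a) := by
    intro s
    have hd : ∀ r, HasDerivAt (fun r => Φ r (linearStat (b r))) 0 r := fun r => by
      have h := hasDerivAt_forward hΦ (hasDerivAt_linearStat (hb r))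
      rw [hL.linearStat] at h
      refine h.congr_deriv ?_
      rw [show linearStat (-bondLaplacian c (b r)) = -linearStat (bondLaplacian c (b r)) from
        funext fun η => linearStat_neg _ η, add_neg_cancel, map_zero]
    rw [is_const_of_deriv_eq_zero (fun r => (hd r).differentiableAt) (fun r => (hd r).deriv) s t,
      hbt]
  set κ := Φ t (linearStat a) with hκ
  -- Half the square sum of the backward flow grows at rate exactly `dirichletForm c (b s) (b s)`,
  -- which dominates the carré du champ; this fixes the factor `1/2`.
  let Q : ℝ → ℝ := fun s =>
    Φ s (fun η => (linearStat (b s) η - κ) ^ 2) - (∑ x, b s x ^ 2) / 2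
  let g : ℝ → Config N → ℝ := fun s η =>
    ∑ x, c x * ((b s (x + 1) - b s x) * (occupation η (x + 1) - occupation η x)) ^ 2
  have hQ : ∀ s, HasDerivAt Q (Φ s (g s) - dirichletForm c (b s) (b s)) s := by
    intro s
    have h1 : HasDerivAt (fun r η => (linearStat (b r) η - κ) ^ 2)
        (fun η => 2 * (linearStat (b s) η - κ) * linearStat (-bondLaplacian c (b s)) η) s := by
      have h := hasDerivAt_linearStat (hb s)
      rw [hasDerivAt_pi] at h ⊢
      intro η
      exact (((h η).sub_const κ).fun_pow 2).congr_deriv (by simp)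
    have h2 := hasDerivAt_forward hΦ h1
    have h3 : HasDerivAt (fun r => (∑ x, b r x ^ 2) / 2) (dirichletForm c (b s) (b s)) s := by
      have h := (HasDerivAt.fun_sum fun x (_ : x ∈ Finset.univ) =>
        ((hasDerivAt_pi.1 (hb s)) x).fun_pow 2).div_const 2
      refine h.congr_deriv ?_
      rw [← neg_neg (dirichletForm c (b s) (b s)), ← sum_bondLaplacian_mul,
        ← Finset.sum_neg_distrib, Finset.sum_div]
      refine Finset.sum_congr rfl fun x _ => ?_
      simp
      ring
    refine (h2.sub h3).congr_deriv ?_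
    congr 2
    funext η
    simp only [Pi.add_apply, hL.sq_linearStat, linearStat_neg, g]
    ring
  have hanti : AntitoneOn Q (Set.Icc 0 t) := by
    refine antitoneOn_of_deriv_nonpos (convex_Icc 0 t)
      (fun s _ => (hQ s).continuousAt.continuousWithinAt)
      (fun s _ => (hQ s).differentiableAt.differentiableWithinAt) fun s hs => ?_
    rw [interior_Icc] at hs
    rw [(hQ s).deriv, sub_nonpos]
    refine hle s hs.1.le _ _ fun η => Finset.sum_le_sum fun x _ => ?_
    refine mul_le_mul_of_nonneg_left ?_ (hc x)
    have h1 : (occupation η (x + 1) - occupation η x) ^ 2 ≤ 1 := by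
      have := occupation_nonneg η (x + 1)
      have := occupation_nonneg η x
      have := occupation_le_one η (x + 1)
      have := occupation_le_one η x
      rw [sq_le_one_iff_abs_le_one, abs_le]
      constructor <;> linarith
    rw [mul_pow, ← sq]
    exact mul_le_of_le_one_right (sq_nonneg _) h1
  have hfin := hanti ⟨le_rfl, ht⟩ ⟨ht, le_rfl⟩ ht
  have h00 := h0 (b 0)
  rw [hconst 0] at h00
  simp only [Q, hbt] at hfin
  linarith

end Moments

end SlowBonds
namespace SlowBonds

/-! ### Boxes of the discrete torus -/

section Boxes

variable (n k : ℕ) [NeZero n] [NeZero k]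

/-- The `j`-th site of the `i`-th box. -/
def site (i : ZMod k) (j : ℕ) : ZMod (n * k) := ((i.val * n + j : ℕ) : ZMod (n * k))

variable {n k}

omit [NeZero n] in
lemma site_index_lt (i : ZMod k) {j : ℕ} (hj : j < n) : i.val * n + j < n * k := by
  have h : (i.val + 1) * n ≤ k * n := Nat.mul_le_mul_right n (ZMod.val_lt i)
  nlinarith

omit [NeZero n] in
lemma val_site (i : ZMod k) {j : ℕ} (hj : j < n) : (site n k i j).val = i.val * n + j :=
  ZMod.val_cast_of_lt (site_index_lt i hj)

omit [NeZero n] [NeZero k] in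
lemma site_add_one (i : ZMod k) (j : ℕ) : site n k i j + 1 = site n k i (j + 1) := by
  simp [site, add_assoc]

omit [NeZero n] in
-- The index `j = n` is one past the box; reduction modulo `k` handles the wrap-around at the last
-- box.
lemma site_box_end (i : ZMod k) : site n k i n = site n k (i + 1) 0 := by
  have h : (i + 1).val = (i.val + 1) % k := by
    rw [ZMod.val_add, ZMod.val_one_eq_one_mod, Nat.add_mod_mod]
  rw [site, site, h, ZMod.natCast_eq_natCast_iff, add_zero, Nat.ModEq, ← Nat.succ_mul,
    mul_comm n k, Nat.mul_mod_mul_right, Nat.mul_mod_mul_right, Nat.mod_mod]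

lemma site_bijective :
    Function.Bijective fun p : ZMod k × Fin n => site n k p.1 (p.2 : ℕ) := by
  rw [Fintype.bijective_iff_injective_and_card]
  refine ⟨fun p q h => ?_, by simp [ZMod.card, mul_comm]⟩
  have h' := congrArg ZMod.val h
  simp only [val_site _ p.2.2, val_site _ q.2.2] at h'
  have h1 := congrArg (· / n) h'
  have h2 := congrArg (· % n) h'
  simp only [add_comm _ (p.2 : ℕ), add_comm _ (q.2 : ℕ),
    Nat.add_mul_div_right _ _ (NeZero.pos n), Nat.add_mul_mod_self_right,
    Nat.div_eq_of_lt p.2.2, Nat.div_eq_of_lt q.2.2, Nat.mod_eq_of_lt p.2.2,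
    Nat.mod_eq_of_lt q.2.2, zero_add] at h1 h2
  exact Prod.ext (ZMod.val_injective k h1) (Fin.ext h2)

lemma sum_site (f : ZMod (n * k) → ℝ) :
    ∑ x, f x = ∑ i : ZMod k, ∑ j ∈ Finset.range n, f (site n k i j) := by
  rw [← site_bijective.sum_comp, Fintype.sum_prod_type]
  exact Finset.sum_congr rfl fun i _ => Fin.sum_univ_eq_sum_range (fun j => f (site n k i j)) n

omit [NeZero n] in
-- The slow bonds are exactly those leaving the last site of a box.
lemma conductance_site (α β : ℝ) (i : ZMod k) {j : ℕ} (hj : j < n) :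
    conductance n k α β (site n k i j) = if j + 1 = n then α * (n : ℝ) ^ (-β) else 1 := by
  have h : (∃ l ∈ Finset.Icc 1 k, (site n k i j).val + 1 = l * n) ↔ j + 1 = n := by
    rw [val_site i hj]
    constructor
    · rintro ⟨l, -, hl⟩
      have hd : n ∣ j + 1 := (Nat.dvd_add_right (Dvd.intro_left i.val rfl)).1
        (Dvd.intro_left l (by rw [← hl, add_assoc]))
      exact le_antisymm hj (Nat.le_of_dvd j.succ_pos hd)
    · intro h
      refine ⟨i.val + 1, Finset.mem_Icc.2 ⟨by omega, ZMod.val_lt i⟩, ?_⟩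
      rw [add_assoc, h, Nat.succ_mul]
  simp only [conductance, h]

variable (n k) in
/-- The jump rates of the speeded up process. -/
noncomputable def rate (α β : ℝ) (x : ZMod (n * k)) : ℝ :=
  (k : ℝ) ^ 2 * (n : ℝ) ^ (1 + β) * conductance n k α β x

omit [NeZero n] [NeZero k] in
lemma rate_nonneg {α : ℝ} (hα : 0 ≤ α) (β : ℝ) (x : ZMod (n * k)) : 0 ≤ rate n k α β x := by
  unfold rate conductance
  split_ifs <;> positivity

omit [NeZero n] in
lemma rate_inner (α β : ℝ) (i : ZMod k) {j : ℕ} (hj : j + 1 < n) :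
    rate n k α β (site n k i j) = (k : ℝ) ^ 2 * (n : ℝ) ^ (1 + β) := by
  rw [rate, conductance_site α β i (by omega), if_neg hj.ne, mul_one]

/-- The speed-up `n^(1+β)` beats `n^(-β)` by one factor `n`, which averaging over a box removes. -/
lemma rate_slow (α β : ℝ) (i : ZMod k) :
    rate n k α β (site n k i (n - 1)) = α * (k : ℝ) ^ 2 * n := by
  have hn : 0 < n := NeZero.pos n
  rw [rate, conductance_site α β i (by omega), if_pos (by omega)]
  have h : (n : ℝ) ^ (1 + β) * (n : ℝ) ^ (-β) = n := by
    rw [← Real.rpow_add (by exact_mod_cast hn)]; simp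
  linear_combination (α * (k : ℝ) ^ 2) * h

lemma isExclusionGenerator_generator (α β : ℝ) :
    IsExclusionGenerator (rate n k α β)
      (((k : ℝ) ^ 2 * (n : ℝ) ^ (1 + β)) • generator n k α β) := by
  intro f η
  simp only [LinearMap.smul_apply, Pi.smul_apply, smul_eq_mul, generator, LinearMap.coe_mk,
    AddHom.coe_mk, Finset.mul_sum, rate]
  exact Finset.sum_congr rfl fun x _ => by ring

/-- The average over the `i`-th box. -/
noncomputable def boxMean (u : ZMod (n * k) → ℝ) (i : ZMod k) : ℝ :=
  (∑ j ∈ Finset.range n, u (site n k i j)) / n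

/-- The Laplacian is a difference of fluxes, so its sum over a box telescopes to the two slow bonds
at the ends. -/
lemma boxMean_bondLaplacian (α β : ℝ) (u : ZMod (n * k) → ℝ) (i : ZMod k) :
    boxMean (bondLaplacian (rate n k α β) u) i = α * (k : ℝ) ^ 2 *
      ((u (site n k (i + 1) 0) - u (site n k i (n - 1))) -
        (u (site n k i 0) - u (site n k (i - 1) (n - 1)))) := by
  have hn : 0 < n := NeZero.pos n
  have hn' : (n : ℝ) ≠ 0 := by exact_mod_cast hn.ne'
  -- The flux through the bond entering the `j`-th site.
  let G : ℕ → ℝ := fun j =>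
    rate n k α β (site n k i j - 1) * (u (site n k i j) - u (site n k i j - 1))
  have hG : ∀ j, bondLaplacian (rate n k α β) u (site n k i j) = G (j + 1) - G j := by
    intro j
    simp only [bondLaplacian, LinearMap.coe_mk, AddHom.coe_mk, G, ← site_add_one,
      add_sub_cancel_right]
    ring
  have hlast : ∀ i : ZMod k, site n k (i + 1) 0 - 1 = site n k i (n - 1) := fun i => by
    rw [← site_box_end, sub_eq_iff_eq_add, site_add_one, Nat.sub_add_cancel hn]
  have h0 : site n k i 0 - 1 = site n k (i - 1) (n - 1) := by simpa using hlast (i - 1)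
  rw [boxMean, Finset.sum_congr rfl fun j _ => hG j, Finset.sum_range_sub]
  simp only [G, site_box_end, hlast, h0, rate_slow]
  field_simp

/-! ### Energy estimates inside the boxes -/

/-- Discrete Poincaré inequality: the oscillation is at most the total variation over the inner
bonds, then Cauchy–Schwarz. -/
lemma sq_sub_average_le (f : ℕ → ℝ) {j : ℕ} (hj : j < n) :
    (f j - (∑ l ∈ Finset.range n, f l) / n) ^ 2 ≤
      n * ∑ l ∈ Finset.range (n - 1), (f (l + 1) - f l) ^ 2 := by
  have hn : 0 < (n : ℝ) := by exact_mod_cast NeZero.pos n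
  set V := ∑ l ∈ Finset.range (n - 1), |f (l + 1) - f l| with hV
  have hmono : ∀ a b, a ≤ b → b < n → |f b - f a| ≤ V := by
    intro a b hab hb
    rw [← Finset.sum_Ico_sub f hab]
    refine (Finset.abs_sum_le_sum_abs _ _).trans ?_
    refine Finset.sum_le_sum_of_subset_of_nonneg (fun l hl => ?_) fun _ _ _ => abs_nonneg _
    rw [Finset.mem_Ico] at hl
    rw [Finset.mem_range]
    omega
  have hosc : ∀ l ∈ Finset.range n, |f j - f l| ≤ V := by
    intro l hl
    rw [Finset.mem_range] at hl
    rcases le_total l j with h | h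
    · exact hmono l j h hj
    · rw [abs_sub_comm]; exact hmono j l h hl
  have habs : |f j - (∑ l ∈ Finset.range n, f l) / n| ≤ V := by
    have h : f j - (∑ l ∈ Finset.range n, f l) / n = (∑ l ∈ Finset.range n, (f j - f l)) / n := by
      rw [Finset.sum_sub_distrib, Finset.sum_const, Finset.card_range, nsmul_eq_mul]
      field_simp
    rw [h, abs_div, abs_of_pos hn, div_le_iff₀ hn]
    calc |∑ l ∈ Finset.range n, (f j - f l)| ≤ ∑ l ∈ Finset.range n, |f j - f l| :=
          Finset.abs_sum_le_sum_abs _ _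
      _ ≤ ∑ _l ∈ Finset.range n, V := Finset.sum_le_sum hosc
      _ = V * n := by rw [Finset.sum_const, Finset.card_range, nsmul_eq_mul, mul_comm]
  calc _ ≤ V ^ 2 := sq_le_sq' (by linarith [(abs_le.1 habs).1]) (abs_le.1 habs).2
    _ ≤ (Finset.range (n - 1)).card * ∑ l ∈ Finset.range (n - 1), |f (l + 1) - f l| ^ 2 :=
        sq_sum_le_card_mul_sum_sq
    _ ≤ _ := by
        simp only [sq_abs, Finset.card_range]
        gcongr
        exact Nat.sub_le n 1

/-- The energy of `u` inside the boxes. -/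
noncomputable def boxEnergy (u : ZMod (n * k) → ℝ) (i : ZMod k) : ℝ :=
  ∑ j ∈ Finset.range (n - 1), (u (site n k i (j + 1)) - u (site n k i j)) ^ 2

omit [NeZero k] in
lemma sq_sub_boxMean_le (u : ZMod (n * k) → ℝ) (i : ZMod k) {j : ℕ} (hj : j < n) :
    (u (site n k i j) - boxMean u i) ^ 2 ≤ n * boxEnergy u i :=
  sq_sub_average_le (fun j => u (site n k i j)) hj

/-- The nonnegative contributions of the slow bonds are dropped. -/
lemma boxEnergy_le_dirichletForm {α : ℝ} (hα : 0 ≤ α) (β : ℝ) (u : ZMod (n * k) → ℝ) :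
    (k : ℝ) ^ 2 * (n : ℝ) ^ (1 + β) * ∑ i : ZMod k, boxEnergy u i ≤
      dirichletForm (rate n k α β) u u := by
  rw [dirichletForm, sum_site, Finset.mul_sum]
  refine Finset.sum_le_sum fun i _ => ?_
  rw [boxEnergy, Finset.mul_sum]
  have h : ∀ j ∈ Finset.range (n - 1), (k : ℝ) ^ 2 * (n : ℝ) ^ (1 + β) *
      (u (site n k i (j + 1)) - u (site n k i j)) ^ 2 = rate n k α β (site n k i j) *
        ((u (site n k i j + 1) - u (site n k i j)) *
          (u (site n k i j + 1) - u (site n k i j))) := by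
    intro j hj
    rw [Finset.mem_range] at hj
    rw [rate_inner α β i (by omega), site_add_one, sq (_ - _)]
  rw [Finset.sum_congr rfl h]
  refine Finset.sum_le_sum_of_subset_of_nonneg (Finset.range_mono (Nat.sub_le n 1)) fun j _ _ => ?_
  exact mul_nonneg (rate_nonneg hα β _) (mul_self_nonneg _)

/-- Dissipation of the distance between the box averages of `u` and `ρ`, up to the energy of `u`
inside the boxes. -/
lemma boxMean_dissipation {α : ℝ} (hα : 0 ≤ α) (β : ℝ) (u : ZMod (n * k) → ℝ) (ρ : ZMod k → ℝ) :
    ∑ i, 2 * (boxMean u i - ρ i) * (boxMean (bondLaplacian (rate n k α β) u) i -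
        bondLaplacian (fun _ => α * (k : ℝ) ^ 2) ρ i) -
      8 * α ^ 2 * (k : ℝ) ^ 2 * (n : ℝ) ^ (-β) * (2 * dirichletForm (rate n k α β) u u) ≤
      ∑ i, (boxMean u i - ρ i) ^ 2 := by
  have hn : 0 < n := NeZero.pos n
  set K := α * (k : ℝ) ^ 2 with hK
  set e : ZMod k → ℝ := fun i => boxMean u i - ρ i with he
  -- Deviations from the box mean at the two ends of a box; `r` is the error from replacing end
  -- values by box means.
  let p : ZMod k → ℝ := fun i => u (site n k i (n - 1)) - boxMean u i
  let q : ZMod k → ℝ := fun i => u (site n k i 0) - boxMean u i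
  let r : ZMod k → ℝ := fun i => K * (q (i + 1) - p i - q i + p (i - 1))
  have hsplit : ∀ i, boxMean (bondLaplacian (rate n k α β) u) i - bondLaplacian (fun _ => K) ρ i =
      bondLaplacian (fun _ => K) e i + r i := by
    intro i
    rw [boxMean_bondLaplacian]
    simp only [bondLaplacian, LinearMap.coe_mk, AddHom.coe_mk, r, p, q, e]
    ring
  have hp : ∀ i, p i ^ 2 ≤ n * boxEnergy u i := fun i => sq_sub_boxMean_le u i (by omega)
  have hq : ∀ i, q i ^ 2 ≤ n * boxEnergy u i := fun i => sq_sub_boxMean_le u i hn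
  have hsum : ∑ i, r i ^ 2 ≤ 16 * K ^ 2 * (n * ∑ i : ZMod k, boxEnergy u i) := by
    have h1 : ∀ i, r i ^ 2 ≤ 4 * K ^ 2 *
        (n * boxEnergy u (i + 1) + n * boxEnergy u i + n * boxEnergy u i +
          n * boxEnergy u (i - 1)) := by
      intro i
      have h : (q (i + 1) - p i - q i + p (i - 1)) ^ 2 ≤
          4 * (q (i + 1) ^ 2 + p i ^ 2 + q i ^ 2 + p (i - 1) ^ 2) := by
        -- The difference of the two sides is the sum of these six squares.
        nlinarith [sq_nonneg (q (i + 1) + p i), sq_nonneg (q (i + 1) + q i),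
          sq_nonneg (q (i + 1) - p (i - 1)), sq_nonneg (p i - q i), sq_nonneg (p i + p (i - 1)),
          sq_nonneg (q i + p (i - 1))]
      have h2 := hq (i + 1)
      have h3 := hp i
      have h4 := hq i
      have h5 := hp (i - 1)
      calc r i ^ 2 = K ^ 2 * (q (i + 1) - p i - q i + p (i - 1)) ^ 2 := by
            simp only [r, mul_pow]
        _ ≤ K ^ 2 * (4 * (n * boxEnergy u (i + 1) + n * boxEnergy u i + n * boxEnergy u i +
              n * boxEnergy u (i - 1))) :=
            mul_le_mul_of_nonneg_left (by linarith) (sq_nonneg K)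
        _ = _ := by ring
    refine (Finset.sum_le_sum fun i _ => h1 i).trans (le_of_eq ?_)
    have hs := sum_shift (fun i : ZMod k => boxEnergy u i)
    have hs' := sum_shift (fun i : ZMod k => boxEnergy u (i - 1))
    simp only [add_sub_cancel_right] at hs'
    rw [← Finset.mul_sum]
    simp only [Finset.sum_add_distrib, ← Finset.mul_sum]
    rw [hs, ← hs']
    ring
  have hD := boxEnergy_le_dirichletForm hα β u
  have hpow : (n : ℝ) ^ (-β) * (n : ℝ) ^ (1 + β) = n := by
    rw [← Real.rpow_add (by exact_mod_cast hn)]; simp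
  -- The constant `8 α² k² n^(-β)` is chosen so that the error is absorbed exactly here.
  have hD' : 16 * K ^ 2 * (n * ∑ i : ZMod k, boxEnergy u i) ≤
      8 * α ^ 2 * (k : ℝ) ^ 2 * (n : ℝ) ^ (-β) * (2 * dirichletForm (rate n k α β) u u) := by
    have h : 0 ≤ 16 * α ^ 2 * (k : ℝ) ^ 2 * (n : ℝ) ^ (-β) := by positivity
    calc _ = 16 * α ^ 2 * (k : ℝ) ^ 2 * (n : ℝ) ^ (-β) *
          ((k : ℝ) ^ 2 * (n : ℝ) ^ (1 + β) * ∑ i : ZMod k, boxEnergy u i) := by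
          rw [hK]
          linear_combination (-16 * α ^ 2 * (k : ℝ) ^ 4 * ∑ i : ZMod k, boxEnergy u i) * hpow
      _ ≤ _ := mul_le_mul_of_nonneg_left hD h
      _ = _ := by ring
  have hlap : ∑ i, bondLaplacian (fun _ => K) e i * e i ≤ 0 := by
    rw [sum_bondLaplacian_mul, neg_nonpos]
    exact dirichletForm_self_nonneg (fun _ => by positivity) e
  have hmain : ∑ i, 2 * e i * (boxMean (bondLaplacian (rate n k α β) u) i -
      bondLaplacian (fun _ => K) ρ i) ≤
      2 * ∑ i, bondLaplacian (fun _ => K) e i * e i + ∑ i, e i ^ 2 + ∑ i, r i ^ 2 := by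
    rw [Finset.mul_sum, ← Finset.sum_add_distrib, ← Finset.sum_add_distrib]
    refine Finset.sum_le_sum fun i _ => ?_
    rw [hsplit]
    -- `2 e r ≤ e² + r²`; the term `e²` is what Grönwall's inequality later pays for.
    nlinarith [sq_nonneg (e i - r i)]
  change ∑ i, 2 * e i * _ - _ ≤ ∑ i, e i ^ 2
  linarith

end Boxes

end SlowBonds
namespace SlowBonds

/-! ### The initial distribution -/

section Initial

variable {N : ℕ} [NeZero N]

instance (γ : C(UnitAddCircle, I)) : IsProbabilityMeasure (initialMeasure N γ) := by
  unfold initialMeasure; infer_instance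

lemma integral_occupation_initialMeasure (γ : C(UnitAddCircle, I)) (x : ZMod N) :
    ∫ η, occupation η x ∂initialMeasure N γ = γ (torusPoint x) := by
  have h := (measurePreserving_eval
    (fun x : ZMod N => bernoulliMeasure true false (γ (torusPoint x))) x).map_eq
  have h2 : ∫ η, occupation η x ∂initialMeasure N γ =
      ∫ y, (if y then (1 : ℝ) else 0) ∂(Measure.map (Function.eval x)
        (initialMeasure N γ)) := by
    rw [integral_map (measurable_pi_apply x).aemeasurable
      (measurable_of_finite _).aestronglyMeasurable]
    rfl
  rw [h2, initialMeasure, h, integral_bernoulliMeasure]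
  simp

/-- By independence variances add up, and a variable in `[0,1]` has variance at most `1/4`. -/
lemma variance_linearStat_initialMeasure_le (γ : C(UnitAddCircle, I)) (a : ZMod N → ℝ) :
    ∫ η, (linearStat a η - ∫ ζ, linearStat a ζ ∂initialMeasure N γ) ^ 2 ∂initialMeasure N γ ≤
      (∑ x, a x ^ 2) / 2 := by
  rw [← variance_eq_integral (measurable_of_finite _).aemeasurable]
  let X : ZMod N → Bool → ℝ := fun x y => a x * if y then 1 else 0
  have hX : linearStat a = ∑ x, fun η : Config N => X x (η x) := by
    funext η
    simp only [Finset.sum_apply]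
    rfl
  have hb : ∀ y : Bool, (if y then (1 : ℝ) else 0) ∈ Set.Icc (0 : ℝ) 1 := by
    intro y; cases y <;> simp
  rw [hX, initialMeasure, variance_sum_pi fun x => MemLp.of_bound
    (measurable_of_finite _).aestronglyMeasurable |a x| (ae_of_all _ fun y => ?_), Finset.sum_div]
  · refine Finset.sum_le_sum fun x _ => ?_
    rw [variance_const_mul]
    have h := variance_le_sq_of_bounded
      (μ := bernoulliMeasure true false (γ (torusPoint x))) (ae_of_all _ hb)
      (measurable_of_finite _).aemeasurable
    nlinarith [sq_nonneg (a x)]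
  · simp only [X, Real.norm_eq_abs, abs_mul]
    exact mul_le_of_le_one_right (abs_nonneg _) (abs_le.2 ⟨by linarith [(hb y).1], (hb y).2⟩)

end Initial

/-! ### Riemann sums -/

section Riemann

lemma torusPoint_site {n k : ℕ} [NeZero k] (i : ZMod k) {j : ℕ} (hj : j < n) :
    torusPoint (site n k i j) =
      (((i.val * n + j : ℝ) / (n * k : ℝ) : ℝ) : UnitAddCircle) := by
  rw [torusPoint, val_site i hj]
  push_cast
  rfl

lemma uniformContinuous_profile (γ : C(UnitAddCircle, I)) :
    UniformContinuous fun x : ℝ => (γ (x : UnitAddCircle) : ℝ) := by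
  have h1 : UniformContinuous fun x : ℝ => (x : UnitAddCircle) :=
    uniformContinuous_addMonoidHom_of_continuous
      (f := QuotientAddGroup.mk' (AddSubgroup.zmultiples (1 : ℝ))) continuous_quotient_mk'
  have h2 : UniformContinuous γ := CompactSpace.uniformContinuous_of_continuous γ.continuous
  exact uniformContinuous_subtype_val.comp (h2.comp h1)

lemma abs_boxMean_sub_profileAverage_le {n k : ℕ} [NeZero n] [NeZero k] (γ : C(UnitAddCircle, I))
    {ε δ : ℝ} (hδ : ∀ x y : ℝ, |x - y| < δ →
      |(γ (x : UnitAddCircle) : ℝ) - γ (y : UnitAddCircle)| ≤ ε)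
    (hn : 1 / (n : ℝ) < δ) (i : ZMod k) :
    |boxMean (n := n) (fun x => (γ (torusPoint x) : ℝ)) i - profileAverage γ i| ≤ ε := by
  have hn0 : (0 : ℝ) < n := by exact_mod_cast NeZero.pos n
  have hk0 : (0 : ℝ) < k := by exact_mod_cast NeZero.pos k
  have hk1 : (1 : ℝ) ≤ k := by exact_mod_cast NeZero.pos k
  let g : ℝ → ℝ := fun x => γ (x : UnitAddCircle)
  -- Subdivision of the box into `n` intervals of length `1/(n k)`; box mean and integral are
  -- compared on each.
  let a : ℕ → ℝ := fun j => (i.val * n + j) / (n * k)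
  have hg : Continuous g := (uniformContinuous_profile γ).continuous
  have hstep : ∀ j, a (j + 1) - a j = 1 / (n * k) := fun j => by
    simp only [a]; push_cast; field_simp; ring
  have hint : profileAverage γ i = k * ∑ j ∈ Finset.range n, ∫ u in a j..a (j + 1), g u := by
    rw [intervalIntegral.sum_integral_adjacent_intervals
      fun j _ => hg.intervalIntegrable _ _, profileAverage]
    have h0 : a 0 = i.val / k := by simp only [a]; push_cast; field_simp; ring
    have h1 : a n = (i.val + 1) / k := by simp only [a]; field_simp
    rw [h0, h1]
  have hmean : boxMean (n := n) (fun x => (γ (torusPoint x) : ℝ)) i =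
      k * ∑ j ∈ Finset.range n, ∫ _u in a j..a (j + 1), g (a j) := by
    rw [boxMean, Finset.mul_sum, Finset.sum_div]
    refine Finset.sum_congr rfl fun j hj => ?_
    rw [torusPoint_site i (Finset.mem_range.1 hj), intervalIntegral.integral_const, hstep,
      smul_eq_mul]
    simp only [g, a]
    field_simp
  have hloc : ∀ j, |(∫ _u in a j..a (j + 1), g (a j)) - ∫ u in a j..a (j + 1), g u| ≤
      ε * (1 / (n * k)) := by
    intro j
    rw [← intervalIntegral.integral_sub intervalIntegrable_const (hg.intervalIntegrable _ _)]
    have h := intervalIntegral.norm_integral_le_of_norm_le_const (a := a j) (b := a (j + 1))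
      (f := fun u => g (a j) - g u) (C := ε) fun u hu => by
        have hpos : (0 : ℝ) ≤ 1 / (n * k) := by positivity
        have hle : 1 / ((n : ℝ) * k) ≤ 1 / n := by
          apply one_div_le_one_div_of_le hn0
          nlinarith
        rw [Set.uIoc_of_le (by linarith [hstep j])] at hu
        refine hδ _ _ (abs_lt.2 ⟨?_, ?_⟩) <;> linarith [hu.1, hu.2, hstep j]
    rwa [Real.norm_eq_abs, hstep,
      abs_of_nonneg (show (0 : ℝ) ≤ 1 / ((n : ℝ) * k) by positivity)] at h
  rw [hmean, hint, ← mul_sub, ← Finset.sum_sub_distrib, abs_mul, abs_of_pos hk0]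
  calc _ ≤ k * ∑ _j ∈ Finset.range n, ε * (1 / (n * k)) := by
        gcongr
        exact (Finset.abs_sum_le_sum_abs _ _).trans (Finset.sum_le_sum fun j _ => hloc j)
    _ = ε := by
        rw [Finset.sum_const, Finset.card_range, nsmul_eq_mul]
        field_simp

lemma tendsto_boxMean_profileAverage {k : ℕ} [NeZero k] (γ : C(UnitAddCircle, I)) (i : ZMod k) :
    Tendsto (fun n : ℕ+ => boxMean (n := n) (fun x => (γ (torusPoint x) : ℝ)) i) atTop
      (𝓝 (profileAverage γ i)) := by
  rw [Metric.tendsto_nhds]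
  intro ε hε
  obtain ⟨δ, hδ, h⟩ := Metric.uniformContinuous_iff.1 (uniformContinuous_profile γ) (ε / 2)
    (half_pos hε)
  have hlim : Tendsto (fun n : ℕ+ => 1 / ((n : ℕ) : ℝ)) atTop (𝓝 0) :=
    tendsto_one_div_atTop_nhds_zero_nat.comp tendsto_PNat_val_atTop_atTop
  filter_upwards [hlim.eventually_lt_const hδ] with n hn
  rw [Real.dist_eq]
  exact (abs_boxMean_sub_profileAverage_le γ (fun x y hxy => (h hxy).le) hn i).trans_lt
    (half_lt_self hε)

end Riemann

/-! ### Convergence of the mean -/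

section Mean

/-- Grönwall's inequality: `exp (-s) * Y s` is nonincreasing. -/
lemma le_exp_mul_of_deriv_le {Y Y' : ℝ → ℝ} (hY : ∀ s, HasDerivAt Y (Y' s) s)
    (hle : ∀ s, Y' s ≤ Y s) {t : ℝ} (ht : 0 ≤ t) : Y t ≤ Real.exp t * Y 0 := by
  have hd : ∀ s, HasDerivAt (fun s => Real.exp (-s) * Y s)
      (Real.exp (-s) * -1 * Y s + Real.exp (-s) * Y' s) s := fun s =>
    ((hasDerivAt_id s).neg.exp).mul (hY s)
  have hanti : Antitone fun s => Real.exp (-s) * Y s := by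
    refine antitone_of_deriv_nonpos (fun s => (hd s).differentiableAt) fun s => ?_
    rw [(hd s).deriv]
    nlinarith [hle s, Real.exp_pos (-s)]
  have h := hanti ht
  simp only [neg_zero, Real.exp_zero, one_mul] at h
  calc Y t = Real.exp t * (Real.exp (-t) * Y t) := by
        rw [← mul_assoc, ← Real.exp_add]; simp
    _ ≤ _ := mul_le_mul_of_nonneg_left h (Real.exp_pos t).le

variable {n k : ℕ} [NeZero n] [NeZero k]

/-- The box averages of the mean profile stay close to the discrete heat equation. -/
lemma sum_sq_boxMean_sub_le {α : ℝ} (hα : 0 ≤ α) (β : ℝ) {u : ℝ → ZMod (n * k) → ℝ}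
    (hu : ∀ s, HasDerivAt u (bondLaplacian (rate n k α β) (u s)) s)
    (hu0 : ∀ x, u 0 x ∈ Set.Icc (0 : ℝ) 1) {ρ : ℝ → ZMod k → ℝ}
    (hρ : ∀ s, HasDerivAt ρ (bondLaplacian (fun _ => α * (k : ℝ) ^ 2) (ρ s)) s)
    {t : ℝ} (ht : 0 ≤ t) :
    ∑ i, (boxMean (u t) i - ρ t i) ^ 2 ≤ Real.exp t * (∑ i, (boxMean (u 0) i - ρ 0 i) ^ 2 +
      8 * α ^ 2 * (k : ℝ) ^ 3 * (n : ℝ) ^ (1 - β)) := by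
  have hn : (0 : ℝ) < n := by exact_mod_cast NeZero.pos n
  set C := 8 * α ^ 2 * (k : ℝ) ^ 2 * (n : ℝ) ^ (-β) with hC
  have hC0 : 0 ≤ C := by positivity
  -- The term `C ∑ u²` supplies the dissipation that absorbs the energy error.
  let Y : ℝ → ℝ := fun s => ∑ i, (boxMean (u s) i - ρ s i) ^ 2 + C * ∑ x, u s x ^ 2
  have hY : ∀ s, HasDerivAt Y
      (∑ i, 2 * (boxMean (u s) i - ρ s i) * (boxMean (bondLaplacian (rate n k α β) (u s)) i -
        bondLaplacian (fun _ => α * (k : ℝ) ^ 2) (ρ s) i) -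
      C * (2 * dirichletForm (rate n k α β) (u s) (u s))) s := by
    intro s
    have h1 : ∀ i, HasDerivAt (fun r => boxMean (u r) i)
        (boxMean (bondLaplacian (rate n k α β) (u s)) i) s := fun i =>
      (HasDerivAt.fun_sum fun j _ => hasDerivAt_pi.1 (hu s) _).div_const _
    have h2 := HasDerivAt.fun_sum fun i (_ : i ∈ Finset.univ) =>
      ((h1 i).sub (hasDerivAt_pi.1 (hρ s) i)).fun_pow 2
    have h3 := (HasDerivAt.fun_sum fun x (_ : x ∈ Finset.univ) =>
      (hasDerivAt_pi.1 (hu s) x).fun_pow 2).const_mul C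
    refine (h2.add h3).congr_deriv ?_
    rw [sub_eq_add_neg, ← mul_neg, ← mul_neg, ← sum_bondLaplacian_mul]
    congr 1
    · exact Finset.sum_congr rfl fun i _ => by simp
    · congr 1
      rw [Finset.mul_sum]
      exact Finset.sum_congr rfl fun x _ => by simp; ring
  have hfin := le_exp_mul_of_deriv_le hY (fun s => ?_) ht
  · have h1 : ∑ x, u 0 x ^ 2 ≤ n * k := by
      calc ∑ x, u 0 x ^ 2 ≤ ∑ _x : ZMod (n * k), (1 : ℝ) :=
            Finset.sum_le_sum fun x _ => pow_le_one₀ (hu0 x).1 (hu0 x).2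
        _ = n * k := by simp [ZMod.card]
    have h2 : C * ∑ x, u 0 x ^ 2 ≤ 8 * α ^ 2 * (k : ℝ) ^ 3 * (n : ℝ) ^ (1 - β) := by
      refine (mul_le_mul_of_nonneg_left h1 hC0).trans (le_of_eq ?_)
      rw [hC, sub_eq_add_neg, Real.rpow_add hn, Real.rpow_one]
      ring
    have h3 : 0 ≤ C * ∑ x, u t x ^ 2 := mul_nonneg hC0 (Finset.sum_nonneg fun x _ => sq_nonneg _)
    calc _ ≤ Y t := le_add_of_nonneg_right h3
      _ ≤ _ := hfin.trans (mul_le_mul_of_nonneg_left (add_le_add_right h2 _) (Real.exp_pos t).le)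
  · refine (boxMean_dissipation hα β (u s) (ρ s)).trans (le_add_of_nonneg_right ?_)
    exact mul_nonneg hC0 (Finset.sum_nonneg fun x _ => sq_nonneg _)

end Mean

end SlowBonds
namespace SlowBonds

/-! ### Law of large numbers for the box averages -/

section BoxLaw

variable {n k : ℕ} [NeZero n] [NeZero k]

/-- Makes a box mean a linear statistic, with weight `1/n` on the box, so that the variance bound
applies. -/
lemma exists_boxMean_weight (i : ZMod k) :
    ∃ a : ZMod (n * k) → ℝ, (∀ u : ZMod (n * k) → ℝ, ∑ x, a x * u x = boxMean u i) ∧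
      ∑ x, a x ^ 2 = 1 / n := by
  have hn : 0 < n := NeZero.pos n
  have hn' : (n : ℝ) ≠ 0 := by exact_mod_cast hn.ne'
  let a : ZMod (n * k) → ℝ := fun x => if x.val / n = i.val then 1 / (n : ℝ) else 0
  have ha : ∀ i', ∀ j ∈ Finset.range n, a (site n k i' j) = if i' = i then 1 / (n : ℝ) else 0 := by
    intro i' j hj
    have hj := Finset.mem_range.1 hj
    have h : (i'.val * n + j) / n = i'.val := by
      rw [add_comm, Nat.add_mul_div_right _ _ hn, Nat.div_eq_of_lt hj, zero_add]
    simp only [a, val_site i' hj, h, (ZMod.val_injective k).eq_iff]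
  refine ⟨a, fun u => ?_, ?_⟩
  · have h : ∀ i', ∑ j ∈ Finset.range n, a (site n k i' j) * u (site n k i' j) =
        if i' = i then boxMean u i' else 0 := by
      intro i'
      rw [Finset.sum_congr rfl fun j hj => by rw [ha i' j hj]]
      split_ifs
      · rw [← Finset.mul_sum, boxMean]; ring
      · simp
    rw [sum_site, Finset.sum_congr rfl fun i' _ => h i']
    simp
  · have h : ∀ i', ∑ j ∈ Finset.range n, a (site n k i' j) ^ 2 =
        if i' = i then 1 / (n : ℝ) else 0 := by
      intro i'
      rw [Finset.sum_congr rfl fun j hj => by rw [ha i' j hj]]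
      split_ifs
      · rw [Finset.sum_const, Finset.card_range, nsmul_eq_mul]; field_simp
      · simp
    rw [sum_site, Finset.sum_congr rfl fun i' _ => h i']
    simp

omit [NeZero n] [NeZero k] in
lemma coe_boxAverage (η : Config (n * k)) (i : ZMod k) :
    (boxAverage η i : ℝ) = boxMean (occupation η) i := by
  simp only [boxAverage, boxMean, NNReal.coe_div, NNReal.coe_sum, NNReal.coe_natCast]
  congr 1
  refine Finset.sum_congr rfl fun j _ => ?_
  unfold occupation site
  split_ifs <;> simp

omit [NeZero k] in
lemma boxMean_mem_Icc {u : ZMod (n * k) → ℝ} (hu : ∀ x, u x ∈ Set.Icc (0 : ℝ) 1) (i : ZMod k) :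
    boxMean u i ∈ Set.Icc (0 : ℝ) 1 := by
  have hn : (0 : ℝ) < n := by exact_mod_cast NeZero.pos n
  refine ⟨div_nonneg (Finset.sum_nonneg fun j _ => (hu _).1) hn.le, ?_⟩
  rw [boxMean, div_le_one hn]
  calc _ ≤ ∑ _j ∈ Finset.range n, (1 : ℝ) := Finset.sum_le_sum fun j _ => (hu _).2
    _ = n := by simp

/-- At a fixed time the box averages concentrate around their means, which are close to the
solution of the discrete heat equation. -/
lemma IsMarkovProcess.exists_boxMean_approx {Ω : Type*} [MeasurableSpace Ω] {P : Measure Ω}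
    [IsProbabilityMeasure P] {α : ℝ} (hα : 0 ≤ α) {β : ℝ} {γ : C(UnitAddCircle, I)}
    {X : ℝ≥0 → Ω → Config (n * k)}
    (hX : IsMarkovProcess P X (((k : ℝ) ^ 2 * (n : ℝ) ^ (1 + β)) • generator n k α β)
      (initialMeasure (n * k) γ))
    {ρ : ℝ → ZMod k → ℝ} (hρ0 : ρ 0 = profileAverage γ)
    (hρ : ∀ s, HasDerivAt ρ (bondLaplacian (fun _ => α * (k : ℝ) ^ 2) (ρ s)) s) (t : ℝ≥0) :
    ∃ m : ZMod k → ℝ, (∀ i, m i ∈ Set.Icc (0 : ℝ) 1) ∧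
      (∀ i, ∫ ω, ((boxAverage (X t ω) i : ℝ) - m i) ^ 2 ∂P ≤ 1 / n) ∧
      ∑ i, (m i - ρ t i) ^ 2 ≤ Real.exp t *
        (∑ i : ZMod k, (boxMean (n := n) (fun x => (γ (torusPoint x) : ℝ)) i - profileAverage γ i) ^ 2 +
          8 * α ^ 2 * (k : ℝ) ^ 3 * (n : ℝ) ^ (1 - β)) := by
  obtain ⟨Φ, hΦ, hE⟩ := hX.exists_expectation
  have hint : ∀ (f : Config (n * k) → ℝ) (s : ℝ≥0), Integrable (fun ω => f (X s ω)) P :=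
    fun f s => Integrable.of_finite (μ := P.map (X s)) (f := f) |>.comp_measurable (hX.measurable s)
  have hL := isExclusionGenerator_generator (n := n) (k := k) α β
  have hle : ∀ s, 0 ≤ s → ∀ (f : Config (n * k) → ℝ) (C : ℝ), (∀ η, f η ≤ C) → Φ s f ≤ C := by
    intro s hs f C hf
    lift s to ℝ≥0 using hs
    rw [hE]
    calc _ ≤ ∫ _ω, C ∂P := integral_mono (hint f s) (integrable_const C) fun ω => hf _
      _ = C := by simp
  have hinit : ∀ f : Config (n * k) → ℝ, Φ 0 f = ∫ η, f η ∂initialMeasure (n * k) γ := by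
    intro f
    rw [← hX.initial, integral_map (hX.measurable 0).aemeasurable
      (measurable_of_finite f).aestronglyMeasurable, ← hE 0 f, NNReal.coe_zero]
  have hu0 : ∀ x, meanProfile Φ 0 x = γ (torusPoint x) := fun x => by
    rw [meanProfile, hinit, integral_occupation_initialMeasure]
  have hmem : ∀ x, meanProfile Φ t x ∈ Set.Icc (0 : ℝ) 1 := fun x => by
    refine ⟨?_, hle t t.2 _ _ fun η => occupation_le_one η x⟩
    rw [meanProfile, hE]
    exact integral_nonneg fun ω => occupation_nonneg _ _
  refine ⟨boxMean (meanProfile Φ t), boxMean_mem_Icc hmem, fun i => ?_, ?_⟩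
  · obtain ⟨a, ha, ha2⟩ := exists_boxMean_weight (n := n) i
    have h := variance_linearStat_le hL hΦ hle (rate_nonneg hα β) (fun a => by
      simp only [hinit]
      exact variance_linearStat_initialMeasure_le γ a) t.2 a
    have hstat : linearStat a = fun η => boxMean (occupation η) i := funext fun η => ha _
    rw [show (t.1 : ℝ) = t from rfl, expectation_linearStat, ha, hE, ha2, hstat] at h
    simp only [coe_boxAverage]
    have : (0 : ℝ) ≤ 1 / n := by positivity
    linarith
  · have h := sum_sq_boxMean_sub_le hα β (hasDerivAt_meanProfile hL hΦ)
      (fun x => by rw [hu0]; exact (γ (torusPoint x)).2) hρ t.2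
    rwa [show meanProfile Φ 0 = fun x => (γ (torusPoint x) : ℝ) from funext hu0, hρ0] at h

end BoxLaw

/-! ### Weak convergence and the discrete heat equation -/

lemma continuous_atomicMeasure {k : ℕ} [NeZero k] :
    Continuous (atomicMeasure : (ZMod k → ℝ≥0) → FiniteMeasure UnitAddCircle) := by
  unfold atomicMeasure
  fun_prop

/-- Continuity in the finitely many weights reduces to a sup-norm ball, and a union bound handles
the coordinates. -/
lemma tendstoInProb_atomicMeasure {A : Type*} {l : Filter A} {k : ℕ} [NeZero k] {Ω : A → Type*}
    [∀ a, MeasurableSpace (Ω a)] {P : ∀ a, Measure (Ω a)} {W : ∀ a, Ω a → ZMod k → ℝ≥0}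
    {w : ZMod k → ℝ≥0}
    (h : ∀ i, ∀ ε > 0, Tendsto (fun a => P a {ω | ε ≤ dist (W a ω i) (w i)}) l (𝓝 0)) :
    TendstoInProb P (fun a ω => atomicMeasure (W a ω)) l (atomicMeasure w) := by
  intro U hU
  obtain ⟨ε, hε, hball⟩ := Metric.mem_nhds_iff.1 (continuous_atomicMeasure.continuousAt hU)
  have hsum : Tendsto (fun a => ∑ i, P a {ω | ε ≤ dist (W a ω i) (w i)}) l (𝓝 0) := by
    simpa using tendsto_finsetSum Finset.univ fun i _ => h i ε hε
  refine tendsto_of_tendsto_of_tendsto_of_le_of_le tendsto_const_nhds hsum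
    (fun _ => zero_le) fun a => ?_
  refine (measure_mono fun ω hω => ?_).trans
    (measure_iUnion_fintype_le (P a) fun i => {ω | ε ≤ dist (W a ω i) (w i)})
  rw [Set.mem_iUnion]
  by_contra! hcon
  refine hω (hball (Metric.mem_ball.2 ((dist_pi_lt_iff hε).2 fun i => ?_)))
  simpa using hcon i

lemma mul_discreteLaplacian {k : ℕ} [NeZero k] (α : ℝ) (ρ : ZMod k → ℝ) (i : ZMod k) :
    α * discreteLaplacian ρ i = bondLaplacian (fun _ => α * (k : ℝ) ^ 2) ρ i := by
  simp only [discreteLaplacian, bondLaplacian, LinearMap.coe_mk, AddHom.coe_mk]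
  ring

lemma SolvesHeat.eqOn {k : ℕ} [NeZero k] {α T : ℝ} {γ : C(UnitAddCircle, I)}
    {ρ ρ' : ℝ → ZMod k → ℝ} (h : SolvesHeat α T γ ρ) (h' : SolvesHeat α T γ ρ') :
    Set.EqOn ρ ρ' (Set.Icc 0 T) := by
  let A := LinearMap.toContinuousLinearMap (bondLaplacian fun _ : ZMod k => α * (k : ℝ) ^ 2)
  have key : ∀ {φ : ℝ → ZMod k → ℝ}, SolvesHeat α T γ φ → ∀ t ∈ Set.Icc 0 T,
      HasDerivWithinAt φ (A (φ t)) (Set.Icc 0 T) t := by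
    intro φ hφ t ht
    rw [hasDerivWithinAt_pi]
    intro i
    exact (hφ.deriv t ht i).congr_deriv (mul_discreteLaplacian α _ i)
  -- Right derivatives on `[0, T)` suffice for uniqueness of solutions of a Lipschitz equation.
  have hIci : ∀ {φ : ℝ → ZMod k → ℝ}, SolvesHeat α T γ φ → ∀ t ∈ Set.Ico 0 T,
      HasDerivWithinAt φ (A (φ t)) (Set.Ici t) t := fun hφ t ht =>
    (key hφ t ⟨ht.1, ht.2.le⟩).mono_of_mem_nhdsWithin (Icc_mem_nhdsGE_of_mem ht)
  refine ODE_solution_unique_of_mem_Icc_right (v := fun _ => A) (s := fun _ => Set.univ)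
    (fun t _ => A.lipschitz.lipschitzOnWith) (fun t ht => (key h t ht).continuousWithinAt)
    (hIci h) (fun _ _ => trivial) (fun t ht => (key h' t ht).continuousWithinAt)
    (hIci h') (fun _ _ => trivial) ?_
  funext i
  rw [h.initial, h'.initial]

/-- Chebyshev's inequality around a sequence of approximate means. -/
lemma tendsto_measure_dist_of_approx {A : Type*} {l : Filter A} {Ω : A → Type*}
    [∀ a, MeasurableSpace (Ω a)] {P : ∀ a, Measure (Ω a)} [∀ a, IsProbabilityMeasure (P a)]
    {Z : ∀ a, Ω a → ℝ} {m v : A → ℝ} {z : ℝ} (hm : Tendsto m l (𝓝 z)) (hv : Tendsto v l (𝓝 0))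
    (hint : ∀ a, Integrable (fun ω => (Z a ω - m a) ^ 2) (P a))
    (hvar : ∀ a, ∫ ω, (Z a ω - m a) ^ 2 ∂P a ≤ v a) {ε : ℝ} (hε : 0 < ε) :
    Tendsto (fun a => P a {ω | ε ≤ |Z a ω - z|}) l (𝓝 0) := by
  have hlim : Tendsto (fun a => ENNReal.ofReal (v a / (ε / 2) ^ 2)) l (𝓝 0) := by
    have h := ENNReal.tendsto_ofReal (hv.div_const ((ε / 2) ^ 2))
    simpa using h
  refine tendsto_of_tendsto_of_tendsto_of_le_of_le' tendsto_const_nhds hlim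
    (Eventually.of_forall fun _ => zero_le) ?_
  filter_upwards [Metric.tendsto_nhds.1 hm (ε / 2) (half_pos hε)] with a ha
  rw [Real.dist_eq] at ha
  have hsub : {ω | ε ≤ |Z a ω - z|} ⊆ {ω | (ε / 2) ^ 2 ≤ (Z a ω - m a) ^ 2} := by
    intro ω hω
    rw [Set.mem_ofPred_eq] at hω ⊢
    rw [← sq_abs (Z a ω - m a)]
    have := abs_sub_le (Z a ω) (m a) z
    exact pow_le_pow_left₀ (half_pos hε).le (by linarith) 2
  have hcheb := mul_meas_ge_le_integral_of_nonneg
    (ae_of_all (P a) fun ω => sq_nonneg (Z a ω - m a)) (hint a) ((ε / 2) ^ 2)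
  refine (measure_mono hsub).trans ?_
  rw [← ofReal_measureReal]
  refine ENNReal.ofReal_le_ofReal ?_
  rw [le_div_iff₀ (by positivity), mul_comm]
  exact hcheb.trans (hvar a)

end SlowBonds

/-! ### Proof of the hydrodynamic limit -/

theorem theorem2p3 (α β : ℝ) (hα : 0 < α) (hβ : 1 < β) (k : ℕ) [NeZero k] (T : ℝ) (hT : 0 < T)
    (γ : C(UnitAddCircle, I))
    {Ω : ℕ+ → Type*} [∀ n, MeasurableSpace (Ω n)]
    (P : ∀ n, Measure (Ω n)) [∀ n, IsProbabilityMeasure (P n)]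
    (η : ∀ n : ℕ+, ℝ≥0 → Ω n → SlowBonds.Config (n * k))
    (hη : ∀ n : ℕ+, SlowBonds.IsMarkovProcess (P n) (η n)
      (((k : ℝ) ^ 2 * (n : ℝ) ^ (1 + β)) • SlowBonds.generator n k α β)
      (SlowBonds.initialMeasure (n * k) γ)) :
    ∃ ρ : ℝ → ZMod k → ℝ,
      SlowBonds.SolvesHeat α T γ ρ ∧
      (∀ ρ' : ℝ → ZMod k → ℝ, SlowBonds.SolvesHeat α T γ ρ' → Set.EqOn ρ' ρ (Set.Icc 0 T)) ∧
      (∀ t ∈ Set.Icc 0 T, ∀ i, ρ t i ∈ Set.Icc (0 : ℝ) 1) ∧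
      ∀ t : ℝ≥0, (t : ℝ) ≤ T →
        SlowBonds.TendstoInProb P (fun n ω => SlowBonds.empirical (η n t ω)) atTop
          (SlowBonds.atomicMeasure fun i => (ρ t i).toNNReal) := by
  obtain ⟨ρ, hρ0, hρ⟩ := SlowBonds.exists_linear_flow
    (SlowBonds.bondLaplacian fun _ : ZMod k => α * (k : ℝ) ^ 2) (SlowBonds.profileAverage γ)
  have hsol : SlowBonds.SolvesHeat α T γ ρ :=
    { initial := fun i => by rw [hρ0]
      deriv := fun t _ i => ((hasDerivAt_pi.1 (hρ t) i).congr_deriv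
        (SlowBonds.mul_discreteLaplacian α (ρ t) i).symm).hasDerivWithinAt }
  choose m hm01 hvar hmean using fun (t : ℝ≥0) (n : ℕ+) =>
    (hη n).exists_boxMean_approx hα.le hρ0 hρ t
  have hbound : ∀ t : ℝ≥0, Tendsto (fun n : ℕ+ => Real.exp t *
      (∑ i : ZMod k, (SlowBonds.boxMean (n := n)
          (fun x => (γ (SlowBonds.torusPoint x) : ℝ)) i - SlowBonds.profileAverage γ i) ^ 2 +
        8 * α ^ 2 * (k : ℝ) ^ 3 * ((n : ℕ) : ℝ) ^ (1 - β))) atTop (𝓝 0) := by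
    intro t
    have h1 := tendsto_finsetSum Finset.univ fun (i : ZMod k) _ =>
      ((SlowBonds.tendsto_boxMean_profileAverage γ i).sub_const
        (SlowBonds.profileAverage γ i)).pow 2
    -- Here `β > 1` enters: boxes equilibrate faster than mass crosses slow bonds.
    have h2 : Tendsto (fun n : ℕ+ => ((n : ℕ) : ℝ) ^ (1 - β)) atTop (𝓝 0) := by
      have h := (tendsto_rpow_neg_atTop (y := β - 1) (by linarith)).comp
        (tendsto_natCast_atTop_atTop.comp tendsto_PNat_val_atTop_atTop)
      simpa [Function.comp_def] using h
    simpa using (h1.add (h2.const_mul (8 * α ^ 2 * (k : ℝ) ^ 3))).const_mul (Real.exp t)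
  have hlim : ∀ (t : ℝ≥0) (i : ZMod k), Tendsto (fun n => m t n i) atTop (𝓝 (ρ t i)) := by
    intro t i
    have hsq : Tendsto (fun n => (m t n i - ρ t i) ^ 2) atTop (𝓝 0) :=
      squeeze_zero (fun n => sq_nonneg _) (fun n => (Finset.single_le_sum
        (f := fun i => (m t n i - ρ t i) ^ 2) (fun i _ => sq_nonneg _)
        (Finset.mem_univ i)).trans (hmean t n)) (hbound t)
    rw [tendsto_iff_dist_tendsto_zero]
    simpa [Real.sqrt_sq_eq_abs, Real.dist_eq] using hsq.sqrt
  -- No maximum principle is needed: `ρ` is a limit of expected box averages.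
  have h01 : ∀ (t : ℝ≥0) (i : ZMod k), ρ t i ∈ Set.Icc (0 : ℝ) 1 := fun t i =>
    isClosed_Icc.mem_of_tendsto (hlim t i) (Eventually.of_forall fun n => hm01 t n i)
  refine ⟨ρ, hsol, fun ρ' h' => h'.eqOn hsol, fun t ht i => h01 ⟨t, ht.1⟩ i, fun t _ => ?_⟩
  refine SlowBonds.tendstoInProb_atomicMeasure fun i ε hε => ?_
  have h := SlowBonds.tendsto_measure_dist_of_approx (P := P)
    (Z := fun n ω => (SlowBonds.boxAverage (η n t ω) i : ℝ)) (v := fun n : ℕ+ => 1 / ((n : ℕ) : ℝ))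
    (hlim t i) (tendsto_one_div_atTop_nhds_zero_nat.comp tendsto_PNat_val_atTop_atTop)
    (fun n => Integrable.of_finite (μ := (P n).map (η n t))
      (f := fun ζ => ((SlowBonds.boxAverage ζ i : ℝ) - m t n i) ^ 2) |>.comp_measurable
        ((hη n).measurable t)) (fun n => hvar t n i) hε
  -- Nonnegativity of `ρ` makes the truncation `toNNReal` harmless.
  simpa only [NNReal.dist_eq, Real.coe_toNNReal _ (h01 t i).1] using h
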